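/- Let $a,b\ge 0$ with $a+b>0$, let $c>0$ and $\Delta t>0$, and consider the linear test system $\mathbf y'=\mathbf\Lambda\mathbf y$ on $\mathbb R^2_{>0}$ with $$\mathbf\Lambda=\mathbf S^+-\mathbf S^-=\begin{pmatrix}-ac & bc\\ a & -b\end{pmatrix},\qquad \mathbf S^+=\begin{pmatrix}0&bc\\a&0\end{pmatrix},\qquad \mathbf S^-=\begin{pmatrix}ac&0\\0&b\end{pmatrix}.$$ Let $\varphi(0)=1$ and $\varphi(x)=(1-e^{-x})/x$ for $x>0$. The GeCo2 scheme with step size $\Delta t$, applied to this system, is the iteration $\mathbf y^{n+1}=\mathbf g(\mathbf y^n)$, $\mathbf y^0\in\mathbb R^2_{>0}$, where for $\mathbf y\in\mathbb R^2_{>0}$ $$\mathbf y^{(2)}=\mathbf y+\Delta t\,\varphi\Big(\Delta t\sum_{i=1}^2\frac{(\mathbf S^-\mathbf y)_i}{y_i}\Big)\mathbf\Lambda\mathbf y,\qquad \mathbf w(\mathbf y)=2\varphi\Big(\Delta t\sum_{i=1}^2\frac{(\mathbf S^-\mathbf y)_i}{y_i}\Big)\mathbf\Lambda\mathbf y-\mathbf\Lambda\mathbf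 y-\mathbf\Lambda\mathbf y^{(2)},$$ $$\mathbf g(\mathbf y)=\mathbf y+\frac{\Delta t}{2}\,\varphi\Big(\Delta t\sum_{i=1}^2\frac{\max(0,w_i(\mathbf y))}{y_i}\Big)\,\mathbf\Lambda\big(\mathbf y+\mathbf y^{(2)}\big).$$ A fixed point $\mathbf y^*$ of $\mathbf g$ is called stable if for every $\varepsilon>0$ there is $\delta>0$ such that $\mathbf y^0\in\mathbb R^2_{>0}$ and $\|\mathbf y^0-\mathbf y^*\|<\delta$ imply $\|\mathbf y^n-\mathbf y^*\|<\varepsilon$ for all $n\ge0$, and unstable if it is not stable. Let $\mathbf y^*\in\mathbb R^2_{>0}$ be a steady state, i.e. $\mathbf\Lambda\mathbf y^*=\mathbf 0$. Then: 1. There is an open neighborhood $\mathcal D\subseteq\mathbb R^2_{>0}$ of $\mathbf y^*$ on which $\mathbf g$ is $\mathcal C^1$ with Lipschitz continuous first derivatives. The stability function is $$R(z)=1+z+\tfrac12 z^2\varphi(\Delta t\,\operatorname{tr}\mathbf S^-),$$ that is, the Jacobian of $\mathbf g$ at $\mathbf y^*$ is $R(\Delta t\,\mathbf\Lambda)$;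 its eigenvalues, with multiplicity, are $1$ and $R(-\Delta t(ac+b))$. If $|R(-\Delta t(ac+b))|<1$, then $\mathbf y^*$ is a stable fixed point of $\mathbf g$, and there exists $\delta>0$ such that for every $\mathbf y^0\in\mathbb R^2_{>0}$ with $y^0_1+c\,y^0_2=y^*_1+c\,y^*_2$ and $\|\mathbf y^0-\mathbf y^*\|<\delta$ one has $\lim_{n\to\infty}\mathbf y^n=\mathbf y^*$. If $|R(-\Delta t(ac+b))|>1$, then $\mathbf y^*$ is an unstable fixed point of $\mathbf g$. 2. The map $\mathbf g$ is not $\mathcal C^2$ on any neighborhood of $\mathbf y^*$. -/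

import Mathlib

open Filter Topology
open scoped Matrix NNReal

noncomputable section

/-- The step size modification function: `φ 0 = 1` and `φ x = (1 - e⁻ˣ) / x` for `x ≠ 0`
(it is only ever evaluated at `x ≥ 0` when the scheme acts on positive vectors). -/
def gecoPhi (x : ℝ) : ℝ := if x = 0 then 1 else (1 - Real.exp (-x)) / x

section Scheme

variable {ι : Type*} [Fintype ι]

/-- The first-stage weight `φ(Δt ∑ᵢ fᵢᴰ(y) / yᵢ)`. -/
def gecoWeight (fD : (ι → ℝ) → ι → ℝ) (Δt : ℝ) (y : ι → ℝ) : ℝ :=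
  gecoPhi (Δt * ∑ i, fD y i / y i)

/-- The second stage `y⁽²⁾ = y + Δt φ(Δt ∑ᵢ fᵢᴰ(y) / yᵢ) f(y)`, where `f = fᴾ - fᴰ`. -/
def geco2Stage (fP fD : (ι → ℝ) → ι → ℝ) (Δt : ℝ) (y : ι → ℝ) : ι → ℝ :=
  y + (Δt * gecoWeight fD Δt y) • (fP y - fD y)

/-- `w(y) = 2 φ(Δt ∑ᵢ fᵢᴰ(y) / yᵢ) f(y) - f(y) - f(y⁽²⁾)`. -/
def geco2W (fP fD : (ι → ℝ) → ι → ℝ) (Δt : ℝ) (y : ι → ℝ) : ι → ℝ :=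
  (2 * gecoWeight fD Δt y) • (fP y - fD y) - (fP y - fD y)
    - (fP (geco2Stage fP fD Δt y) - fD (geco2Stage fP fD Δt y))

/-- One step `yⁿ ↦ yⁿ⁺¹` of the second order GeCo scheme with step size `Δt` for the autonomous
production-destruction system `y' = f(y) = fᴾ(y) - fᴰ(y)`:
`yⁿ⁺¹ = yⁿ + (Δt / 2) φ(Δt ∑ᵢ max(0, wᵢ(yⁿ)) / yᵢⁿ) (f(yⁿ) + f(y⁽²⁾))`. -/
def geco2Step (fP fD : (ι → ℝ) → ι → ℝ) (Δt : ℝ) (y : ι → ℝ) : ι → ℝ :=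
  y + (Δt / 2 * gecoPhi (Δt * ∑ i, max 0 (geco2W fP fD Δt y i) / y i)) •
    ((fP y - fD y) + (fP (geco2Stage fP fD Δt y) - fD (geco2Stage fP fD Δt y)))

/-- The set of (componentwise) positive vectors. -/
def posVectors (ι : Type*) : Set (ι → ℝ) := {y | ∀ i, 0 < y i}

/-- `y` is a Lyapunov stable fixed point of the iteration `yⁿ⁺¹ = g(yⁿ)` on `D`. -/
def IsLyapunovStable (g : (ι → ℝ) → ι → ℝ) (D : Set (ι → ℝ)) (y : ι → ℝ) : Prop :=
  g y = y ∧ ∀ ε > 0, ∃ δ > 0, ∀ y₀ ∈ D, ‖y₀ - y‖ < δ → ∀ n : ℕ, ‖g^[n] y₀ - y‖ < ε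

/-- `y` is an unstable fixed point of the iteration: a fixed point that is not Lyapunov stable. -/
def IsUnstable (g : (ι → ℝ) → ι → ℝ) (D : Set (ι → ℝ)) (y : ι → ℝ) : Prop :=
  g y = y ∧ ¬ IsLyapunovStable g D y

/-- `R` is the stability function, at the steady state `y` of `y' = Λ y`, of the one-step method
generated by `g` with step size `Δt`: the Jacobian of `g` at `y` is `R(Δt Λ)`. -/
def IsStabilityFunctionAt [DecidableEq ι] (R : Polynomial ℝ) (g : (ι → ℝ) → ι → ℝ)
    (Λ : Matrix ι ι ℝ) (Δt : ℝ) (y : ι → ℝ) : Prop :=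
  HasFDerivAt g (Matrix.toLin' (Polynomial.aeval (Δt • Λ) R)).toContinuousLinearMap y

end Scheme

/-- The production matrix of the test system. -/
def testSPlus (a b c : ℝ) : Matrix (Fin 2) (Fin 2) ℝ := !![0, b * c; a, 0]

/-- The destruction matrix of the test system. -/
def testSMinus (a b c : ℝ) : Matrix (Fin 2) (Fin 2) ℝ := !![a * c, 0; 0, b]

/-- The system matrix `Λ = S⁺ - S⁻` of the test system `y' = Λ y`. -/
def testLambda (a b c : ℝ) : Matrix (Fin 2) (Fin 2) ℝ := testSPlus a b c - testSMinus a b c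

/-- The map generating the GeCo2 iterates for the test system `y' = S⁺ y - S⁻ y`. -/
def geco2Map (a b c Δt : ℝ) : (Fin 2 → ℝ) → Fin 2 → ℝ :=
  geco2Step (fun y => testSPlus a b c *ᵥ y) (fun y => testSMinus a b c *ᵥ y) Δt

/-- The polynomial `R(z) = 1 + z + ½ z² φ(Δt tr S⁻)`. -/
def geco2R (a b c Δt : ℝ) : Polynomial ℝ :=
  1 + Polynomial.X
    + Polynomial.C (1 / 2 * gecoPhi (Δt * (testSMinus a b c).trace)) * Polynomial.X ^ 2

end

/-! Everything is rank one: `Λ y = ℓ(y) v` with `v = (c, -1)` and `ℓ(v) = -s`, where `s = a c + b >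
0`. Since `S⁻` is diagonal, the inner weight is the constant `φ(T)`, `T = Δt s`, and `T φ(T) = 1 -
exp(-T)` makes the stage scale `ℓ` by `exp(-T)`. Hence `w` is a negative multiple of `ℓ(y) v`, the
sign coming from `2 φ(T) < 1 + exp(-T)`, and the scheme is `g(y) = y + K ω(y) ℓ(y) v`
(`geco2Map_eq`), with `ω = 1` on the line `ℓ = 0`.

The weight `ω` is smooth on each side of that line, with a kink across it. The factor `ℓ` hides the
kink to first order, so both smooth branches have derivative `id + K ℓ ⊗ v` there; this gives `C¹`
with Lipschitz derivative and the Jacobian. To second order the kink survives, because `φ'(0) =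
-1/2` and the argument of `φ` has one-sided slopes of opposite signs along `v`.

The eigenvalue `1` makes linearization alone inconclusive. Instead, `y₁ + c y₂` is conserved exactly
and `ℓ` is multiplied by `1 - K ω(y) s`, which tends to `R(-Δt s)` at the steady state. These two
functionals are linear coordinates, so the dynamics reduces to a scalar recursion. -/

/-! ### The function `φ`. -/

theorem Real.hasDerivAt_exp_neg (x : ℝ) :
    HasDerivAt (fun x : ℝ => Real.exp (-x)) (-Real.exp (-x)) x := by
  simpa using (hasDerivAt_neg x).exp

/-- A divided difference of an analytic function is analytic, so the singularity of `φ` at `0` is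
removable. -/
theorem gecoPhi_eq_dslope : gecoPhi = dslope (fun x : ℝ => -Real.exp (-x)) 0 := by
  funext x
  rcases eq_or_ne x 0 with rfl | hx
  · have h : HasDerivAt (fun x : ℝ => -Real.exp (-x)) 1 0 := by
      simpa [Pi.neg_def] using (Real.hasDerivAt_exp_neg 0).neg
    simp [gecoPhi, dslope_same, h.deriv]
  · rw [dslope_of_ne _ hx, slope_def_field]
    simp [gecoPhi, hx]
    ring

theorem contDiff_gecoPhi {n : WithTop ℕ∞} : ContDiff ℝ n gecoPhi := by
  rw [contDiff_iff_contDiffAt]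
  intro x
  rcases eq_or_ne x 0 with rfl | hx
  · have h : AnalyticAt ℝ (fun x : ℝ => -Real.exp (-x)) 0 :=
      (analyticAt_rexp.comp analyticAt_id.neg).neg
    obtain ⟨p, hp⟩ := h
    rw [gecoPhi_eq_dslope]
    exact AnalyticAt.contDiffAt ⟨_, hp.has_fpower_series_dslope_fslope⟩
  · have h : ContDiffAt ℝ n (fun x : ℝ => (1 - Real.exp (-x)) / x) x := by
      fun_prop (disch := exact hx)
    refine h.congr_of_eventuallyEq ?_
    filter_upwards [isOpen_ne.mem_nhds hx] with y hy
    exact if_neg hy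

theorem gecoPhi_zero : gecoPhi 0 = 1 := if_pos rfl

theorem mul_gecoPhi (x : ℝ) : x * gecoPhi x = 1 - Real.exp (-x) := by
  unfold gecoPhi
  split_ifs with h
  · simp [h]
  · field_simp

/-- Differentiating `x φ(x) = 1 - exp(-x)` twice at `0` gives `2 φ'(0) = -1`. -/
theorem hasDerivAt_gecoPhi_zero : HasDerivAt gecoPhi (-1 / 2) 0 := by
  have hd : Differentiable ℝ gecoPhi := (contDiff_gecoPhi (n := 1)).differentiable (by norm_num)
  have hdd : Differentiable ℝ (deriv gecoPhi) :=
    ((contDiff_gecoPhi (n := 2)).differentiable_deriv_two)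
  have h1 : (fun x => gecoPhi x + x * deriv gecoPhi x) = fun x => Real.exp (-x) := by
    funext x
    have e1 := (hasDerivAt_id x).mul (hd x).hasDerivAt
    have e2 : HasDerivAt (fun x : ℝ => 1 - Real.exp (-x)) (Real.exp (-x)) x := by
      simpa using (Real.hasDerivAt_exp_neg x).const_sub 1
    have e3 : (id * gecoPhi : ℝ → ℝ) = fun x => 1 - Real.exp (-x) := funext mul_gecoPhi
    rw [e3] at e1
    simpa using e1.unique e2
  have e1 := (hd 0).hasDerivAt.add ((hasDerivAt_id (0 : ℝ)).mul (hdd 0).hasDerivAt)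
  have e2 : HasDerivAt (fun x : ℝ => Real.exp (-x)) (-1) 0 := by
    simpa using Real.hasDerivAt_exp_neg 0
  have e4 := e1.unique (h1 ▸ e2)
  simp at e4
  have e5 : deriv gecoPhi 0 = -1 / 2 := by linarith
  exact e5 ▸ (hd 0).hasDerivAt

/-- Equivalently, `tanh (x / 2) < x / 2`. -/
theorem two_mul_gecoPhi_lt {x : ℝ} (hx : 0 < x) : 2 * gecoPhi x < 1 + Real.exp (-x) := by
  -- The claim multiplied by `t`: this function vanishes at `0` and increases because `1 + t < exp
  -- t`.
  have hd : ∀ t : ℝ, HasDerivAt (fun t => t * (1 + Real.exp (-t)) - 2 * (1 - Real.exp (-t)))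
      (1 - (1 + t) * Real.exp (-t)) t := by
    intro t
    have e := Real.hasDerivAt_exp_neg t
    refine (((hasDerivAt_id t).mul (e.const_add 1)).sub
      ((e.const_sub 1).const_mul 2)).congr_deriv ?_
    simp only [id]
    ring
  have hm := strictMonoOn_of_deriv_pos (convex_Ici (0 : ℝ))
    (fun t _ => (hd t).continuousAt.continuousWithinAt) (by
      intro t ht
      rw [interior_Ici, Set.mem_Ioi] at ht
      rw [(hd t).deriv]
      have h1 : t + 1 < Real.exp t := Real.add_one_lt_exp ht.ne'
      have h2 : Real.exp t * Real.exp (-t) = 1 := by rw [← Real.exp_add]; simp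
      nlinarith [Real.exp_pos (-t)])
  have h := hm (Set.mem_Ici.2 le_rfl) (Set.mem_Ici.2 hx.le) hx
  simp only [neg_zero, Real.exp_zero, zero_mul, sub_self, mul_zero] at h
  rw [← mul_gecoPhi] at h
  nlinarith

/-! ### Gluing maps across a hyperplane. -/

section Gluing

variable {E F : Type*} [NormedAddCommGroup E] [NormedSpace ℝ E] [NormedAddCommGroup F]
  [NormedSpace ℝ F]

/-- A map glued along a hyperplane from two differentiable maps whose derivatives agree there. -/
theorem hasFDerivAt_of_eq_on_halfspaces {L : E →L[ℝ] ℝ} {s : Set E} (hs : IsOpen s)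
    {f f₁ f₂ : E → F} {f₁' f₂' : E → E →L[ℝ] F}
    (h₁ : ∀ x ∈ s, 0 ≤ L x → f x = f₁ x) (h₂ : ∀ x ∈ s, L x ≤ 0 → f x = f₂ x)
    (hd₁ : ∀ x ∈ s, HasFDerivAt f₁ (f₁' x) x) (hd₂ : ∀ x ∈ s, HasFDerivAt f₂ (f₂' x) x)
    (h₁₂ : ∀ x ∈ s, L x = 0 → f₁' x = f₂' x) {x : E} (hx : x ∈ s) :
    HasFDerivAt f (if 0 ≤ L x then f₁' x else f₂' x) x := by
  have hsx := hs.mem_nhds hx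
  rcases lt_trichotomy (L x) 0 with h | h | h
  · rw [if_neg h.not_ge]
    refine (hd₂ x hx).congr_of_eventuallyEq ?_
    filter_upwards [hsx, L.continuous.continuousAt.eventually_lt_const h] with y hy hy'
    exact h₂ y hy hy'.le
  · rw [if_pos h.ge]
    have w₁ : HasFDerivWithinAt f (f₁' x) {y | 0 ≤ L y} x :=
      (hd₁ x hx).hasFDerivWithinAt.congr_of_eventuallyEq
        (by filter_upwards [self_mem_nhdsWithin, mem_nhdsWithin_of_mem_nhds hsx] with y hy hy'
            exact h₁ y hy' hy) (h₁ x hx h.ge)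
    have w₂ : HasFDerivWithinAt f (f₁' x) {y | L y ≤ 0} x := by
      rw [h₁₂ x hx h]
      exact (hd₂ x hx).hasFDerivWithinAt.congr_of_eventuallyEq
        (by filter_upwards [self_mem_nhdsWithin, mem_nhdsWithin_of_mem_nhds hsx] with y hy hy'
            exact h₂ y hy' hy) (h₂ x hx h.le)
    have w := w₁.union w₂
    have hu : {y | 0 ≤ L y} ∪ {y | L y ≤ 0} = Set.univ :=
      Set.eq_univ_of_forall fun y => le_total 0 (L y)
    rwa [hu, hasFDerivWithinAt_univ] at w
  · rw [if_pos h.le]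
    refine (hd₁ x hx).congr_of_eventuallyEq ?_
    filter_upwards [hsx, L.continuous.continuousAt.eventually_const_lt h] with y hy hy'
    exact h₁ y hy hy'.le

/-- Two Lipschitz maps that agree on a hyperplane glue to a Lipschitz map. -/
theorem lipschitzOnWith_ite_halfspace {L : E →L[ℝ] ℝ} {s : Set E} (hs : Convex ℝ s) {K : ℝ≥0}
    {X : Type*} [PseudoMetricSpace X] {f₁ f₂ : E → X} (h₁ : LipschitzOnWith K f₁ s) (h₂ : LipschitzOnWith K f₂ s)
    (h₁₂ : ∀ x ∈ s, L x = 0 → f₁ x = f₂ x) :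
    LipschitzOnWith K (fun x => if 0 ≤ L x then f₁ x else f₂ x) s := by
  have key : ∀ x ∈ s, ∀ y ∈ s, 0 ≤ L x → L y < 0 → dist (f₁ x) (f₂ y) ≤ K * dist x y := by
    intro x hx y hy hLx hLy
    -- The segment from `x` to `y` crosses the hyperplane at this parameter. Distances add along the
    -- segment, so the constant `K` is not enlarged.
    set t : ℝ := L x / (L x - L y) with ht
    have hp : 0 < L x - L y := by linarith
    have ht0 : 0 ≤ t := div_nonneg hLx hp.le
    have ht1 : t ≤ 1 := (div_le_one hp).2 (by linarith)
    set z := AffineMap.lineMap x y t with hz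
    have hzs : z ∈ s := hs.lineMap_mem hx hy ⟨ht0, ht1⟩
    have hLz : L z = 0 := by
      rw [hz, AffineMap.lineMap_apply_module]
      simp only [map_add, map_smul, smul_eq_mul, ht]
      field_simp
      ring
    calc dist (f₁ x) (f₂ y) ≤ dist (f₁ x) (f₁ z) + dist (f₁ z) (f₂ y) := dist_triangle _ _ _
      _ ≤ K * dist x z + K * dist z y := by
        refine add_le_add (h₁.dist_le_mul x hx z hzs) ?_
        rw [h₁₂ z hzs hLz]
        exact h₂.dist_le_mul z hzs y hy
      _ = K * dist x y := by
        rw [hz, dist_left_lineMap, dist_lineMap_right, Real.norm_of_nonneg ht0,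
          Real.norm_of_nonneg (by linarith : 0 ≤ 1 - t)]
        ring
  refine LipschitzOnWith.of_dist_le_mul fun x hx y hy => ?_
  split_ifs with hLx hLy hLy
  · exact h₁.dist_le_mul x hx y hy
  · exact key x hx y hy hLx (not_le.1 hLy)
  · rw [dist_comm, dist_comm x]
    exact key y hy x hx hLy (not_le.1 hLx)
  · exact h₂.dist_le_mul x hx y hy

/-- A map glued along a hyperplane from two `C²` maps whose derivatives agree there is locally
`C¹` with Lipschitz continuous derivative. -/
theorem exists_contDiffOn_one_lipschitzOnWith_fderiv {L : E →L[ℝ] ℝ} {x₀ : E} {s : Set E}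
    (hs : IsOpen s) (hx₀ : x₀ ∈ s) {f f₁ f₂ : E → F}
    (h₁ : ∀ x ∈ s, 0 ≤ L x → f x = f₁ x) (h₂ : ∀ x ∈ s, L x ≤ 0 → f x = f₂ x)
    (hf₁ : ∀ x ∈ s, ContDiffAt ℝ 2 f₁ x) (hf₂ : ∀ x ∈ s, ContDiffAt ℝ 2 f₂ x)
    (h₁₂ : ∀ x ∈ s, L x = 0 → fderiv ℝ f₁ x = fderiv ℝ f₂ x) :
    ∃ D ⊆ s, IsOpen D ∧ x₀ ∈ D ∧ ContDiffOn ℝ 1 f D ∧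
      ∃ K : ℝ≥0, LipschitzOnWith K (fderiv ℝ f) D := by
  obtain ⟨K₁, t₁, ht₁, hK₁⟩ :=
    ((hf₁ x₀ hx₀).fderiv_right (m := 1) (by norm_num)).exists_lipschitzOnWith
  obtain ⟨K₂, t₂, ht₂, hK₂⟩ :=
    ((hf₂ x₀ hx₀).fderiv_right (m := 1) (by norm_num)).exists_lipschitzOnWith
  -- A ball, because gluing Lipschitz bounds requires a convex set.
  obtain ⟨r, hr, hball⟩ := Metric.mem_nhds_iff.1
    (Filter.inter_mem (Filter.inter_mem ht₁ ht₂) (hs.mem_nhds hx₀))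
  have hDs : Metric.ball x₀ r ⊆ s := fun x hx => (hball hx).2
  have hd : ∀ x ∈ Metric.ball x₀ r,
      HasFDerivAt f (if 0 ≤ L x then fderiv ℝ f₁ x else fderiv ℝ f₂ x) x := fun x hx =>
    hasFDerivAt_of_eq_on_halfspaces hs h₁ h₂
      (fun y hy => ((hf₁ y hy).differentiableAt (by norm_num)).hasFDerivAt)
      (fun y hy => ((hf₂ y hy).differentiableAt (by norm_num)).hasFDerivAt) h₁₂ (hDs hx)
  have hlip : LipschitzOnWith (max K₁ K₂) (fderiv ℝ f) (Metric.ball x₀ r) := by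
    have h := lipschitzOnWith_ite_halfspace (L := L) (convex_ball x₀ r)
      ((hK₁.mono fun x hx => (hball hx).1.1).weaken (le_max_left K₁ K₂))
      ((hK₂.mono fun x hx => (hball hx).1.2).weaken (le_max_right K₁ K₂))
      (fun x hx => h₁₂ x (hDs hx))
    intro x hx y hy
    rw [(hd x hx).fderiv, (hd y hy).fderiv]
    exact h hx hy
  refine ⟨_, hDs, Metric.isOpen_ball, Metric.mem_ball_self hr, ?_, _, hlip⟩
  rw [show (1 : WithTop ℕ∞) = 0 + 1 by norm_num,
    contDiffOn_succ_iff_fderiv_of_isOpen Metric.isOpen_ball]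
  exact ⟨fun x hx => (hd x hx).differentiableAt.differentiableWithinAt, by simp,
    contDiffOn_zero.2 hlip.continuousOn⟩

/-- The product rule at a zero of a linear factor. -/
theorem hasFDerivAt_mul_of_apply_eq_zero {L : E →L[ℝ] ℝ} {θ : E → ℝ} {x : E}
    (hθ : DifferentiableAt ℝ θ x) (hx : L x = 0) :
    HasFDerivAt (fun y => θ y * L y) (θ x • L) x := by
  refine (hθ.hasFDerivAt.mul L.hasFDerivAt).congr_fderiv ?_
  rw [hx, zero_smul, add_zero]

end Gluing

/-! ### One-sided second derivatives. -/

theorem iteratedDeriv_two_id_mul {θ : ℝ → ℝ} (hθ : ContDiffAt ℝ 2 θ 0) :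
    iteratedDeriv 2 (fun t => t * θ t) 0 = 2 * deriv θ 0 := by
  have hd : ∀ᶠ t in 𝓝 (0 : ℝ), DifferentiableAt ℝ θ t := by
    filter_upwards [hθ.eventually (by simp)] with t ht
    exact ht.differentiableAt (by norm_num)
  have h1 : deriv (fun t => t * θ t) =ᶠ[𝓝 0] fun t => θ t + t * deriv θ t := by
    filter_upwards [hd] with t ht
    simpa using ((hasDerivAt_id' t).fun_mul ht.hasDerivAt).deriv
  have h2 : DifferentiableAt ℝ (deriv θ) 0 := by
    have h := (hθ.fderiv_right (m := 1) (by norm_num)).differentiableAt (by norm_num)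
    exact h.clm_apply (differentiableAt_const (1 : ℝ))
  rw [iteratedDeriv_succ, iteratedDeriv_one, h1.deriv_eq]
  have := (hd.self_of_nhds.hasDerivAt.add ((hasDerivAt_id (0 : ℝ)).mul h2.hasDerivAt)).deriv
  simp only [id, one_mul, zero_mul, add_zero] at this
  rw [two_mul, ← this]
  rfl

/-- If a `C²` function is `t * θ₁ t` to the right of `0` and `t * θ₂ t` to the left of `0`, then
`θ₁` and `θ₂` have the same derivative at `0`. -/
theorem deriv_eq_of_contDiffAt_two {f θ₁ θ₂ : ℝ → ℝ} (hf : ContDiffAt ℝ 2 f 0)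
    (hθ₁ : ContDiffAt ℝ 2 θ₁ 0) (hθ₂ : ContDiffAt ℝ 2 θ₂ 0)
    (h₁ : ∀ᶠ t in 𝓝 0, 0 ≤ t → f t = t * θ₁ t) (h₂ : ∀ᶠ t in 𝓝 0, t ≤ 0 → f t = t * θ₂ t) :
    deriv θ₁ 0 = deriv θ₂ 0 := by
  -- For a `C²` function, the values on either closed half-line alone determine the second
  -- derivative at `0`.
  have key : ∀ {s : Set ℝ} {θ : ℝ → ℝ}, UniqueDiffOn ℝ s → (0 : ℝ) ∈ s → ContDiffAt ℝ 2 θ 0 →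
      f =ᶠ[𝓝[s] 0] (fun t => t * θ t) → iteratedDeriv 2 f 0 = 2 * deriv θ 0 := by
    intro s θ hs h0 hθ h
    rw [← iteratedDeriv_two_id_mul hθ, ← iteratedDerivWithin_eq_iteratedDeriv hs hf h0,
      ← iteratedDerivWithin_eq_iteratedDeriv hs (contDiffAt_fun_id.mul hθ) h0]
    exact h.iteratedDerivWithin_eq (h.self_of_nhdsWithin h0)
  have e₁ := key (uniqueDiffOn_Ici 0) Set.self_mem_Ici hθ₁ (eventually_nhdsWithin_iff.2 h₁)
  have e₂ := key (uniqueDiffOn_Iic 0) Set.self_mem_Iic hθ₂ (eventually_nhdsWithin_iff.2 h₂)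
  linarith

/-! ### Rank-one form of the scheme and its stability function. -/

/-- The linear functional `ℓ y = b y₁ - a y₀`, for which `Λ y = ℓ y • (c, -1)`. -/
noncomputable def steadyFunctional (a b : ℝ) : (Fin 2 → ℝ) →L[ℝ] ℝ :=
  b • ContinuousLinearMap.proj 1 - a • ContinuousLinearMap.proj 0

theorem steadyFunctional_apply (a b : ℝ) (y : Fin 2 → ℝ) :
    steadyFunctional a b y = b * y 1 - a * y 0 := rfl

theorem steadyFunctional_dir (a b c : ℝ) :
    steadyFunctional a b ![c, -1] = -(a * c + b) := by
  simp [steadyFunctional_apply]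
  ring

/-- `Λ y = ℓ y • (c, -1)`. -/
theorem testLambda_mulVec (a b c : ℝ) (y : Fin 2 → ℝ) :
    testLambda a b c *ᵥ y = steadyFunctional a b y • ![c, -1] := by
  ext i
  fin_cases i <;>
    simp [testLambda, testSPlus, testSMinus, Matrix.mulVec, dotProduct, Fin.sum_univ_two,
      steadyFunctional_apply] <;> ring

theorem steadyFunctional_eq_zero {a b c : ℝ} {y : Fin 2 → ℝ}
    (h : testLambda a b c *ᵥ y = 0) : steadyFunctional a b y = 0 := by
  have h1 := congrFun h 1
  rw [testLambda_mulVec] at h1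
  simpa using h1

/-- The combined Runge-Kutta type factor `(Δt / 2) (1 + exp (-Δt tr S⁻))`. -/
noncomputable def gecoGain (a b c Δt : ℝ) : ℝ :=
  Δt / 2 * (1 + Real.exp (-(Δt * (a * c + b))))

/-- The factor in front of the kinked argument of the outer weight. -/
noncomputable def gecoKink (a b c Δt : ℝ) : ℝ :=
  Δt * (1 + Real.exp (-(Δt * (a * c + b))) - 2 * gecoPhi (Δt * (a * c + b)))

/-- The outer weight of the scheme, as a function of the state. -/
noncomputable def outerWeight (a b c C : ℝ) (y : Fin 2 → ℝ) : ℝ :=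
  gecoPhi (C * (max 0 (steadyFunctional a b y) / y 1 +
    c * max 0 (-steadyFunctional a b y) / y 0))

/-- The quotients in the inner weight sum to `tr S⁻`, whatever `y` is. The identity for `T φ(T)`
then gives the stage, and `q > 0` lets `q` be pulled out of the maxima, so only the sign of `ℓ`
decides which component contributes. -/
theorem geco2Map_eq {a b c Δt : ℝ} (hc : 0 < c) (hΔt : 0 < Δt) (hs : 0 < a * c + b)
    {y : Fin 2 → ℝ} (hy : y ∈ posVectors (Fin 2)) :
    geco2Map a b c Δt y = y + (gecoGain a b c Δt * outerWeight a b c (gecoKink a b c Δt) y *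
      steadyFunctional a b y) • ![c, -1] := by
  have hy0 : y 0 ≠ 0 := (hy 0).ne'
  have hy1 : y 1 ≠ 0 := (hy 1).ne'
  set T := Δt * (a * c + b) with hT
  have hTpos : 0 < T := mul_pos hΔt hs
  set p := gecoPhi T with hp
  set l := steadyFunctional a b y with hl
  set q := 1 + Real.exp (-T) - 2 * p with hq
  have hqpos : 0 < q := by
    have := two_mul_gecoPhi_lt hTpos
    linarith
  have hTp : T * p = 1 - Real.exp (-T) := mul_gecoPhi T
  have hf : ∀ z : Fin 2 → ℝ, testSPlus a b c *ᵥ z - testSMinus a b c *ᵥ z =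
      steadyFunctional a b z • ![c, -1] := fun z => by
    rw [← Matrix.sub_mulVec]
    exact testLambda_mulVec a b c z
  have hw : gecoWeight (fun y => testSMinus a b c *ᵥ y) Δt y = p := by
    rw [gecoWeight, hp, hT]
    congr 2
    simp [testSMinus, Fin.sum_univ_two, Matrix.mulVec, dotProduct, hy0, hy1]
  have hstage : steadyFunctional a b (geco2Stage (fun y => testSPlus a b c *ᵥ y)
      (fun y => testSMinus a b c *ᵥ y) Δt y) = Real.exp (-T) * l := by
    rw [geco2Stage, hw, hf, map_add, map_smul, map_smul, steadyFunctional_dir]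
    simp only [smul_eq_mul, ← hl]
    linear_combination (-l) * hTp
  have hW : geco2W (fun y => testSPlus a b c *ᵥ y) (fun y => testSMinus a b c *ᵥ y) Δt y =
      (-(q * l)) • ![c, -1] := by
    rw [geco2W, hw, hf, hf, hstage, hq, ← hl]
    module
  have e0 : max 0 (-(q * l) * c) = q * (c * max 0 (-l)) := by
    rw [← mul_assoc, mul_max_of_nonneg _ _ (by positivity)]
    congr 1 <;> ring
  have e1 : max 0 (q * l) = q * max 0 l := by
    rw [mul_max_of_nonneg _ _ hqpos.le, mul_zero]
  rw [geco2Map, geco2Step, hf, hf, hstage, hW, ← add_smul, smul_smul, ← hl]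
  congr 2
  have hsum : Δt * ∑ i, max 0 (((-(q * l)) • ![c, -1]) i) / y i =
      gecoKink a b c Δt * (max 0 l / y 1 + c * max 0 (-l) / y 0) := by
    simp only [Fin.sum_univ_two, Pi.smul_apply, Matrix.cons_val_zero, Matrix.cons_val_one,
      smul_eq_mul, e0, mul_neg, mul_one, neg_neg, e1]
    rw [gecoKink, ← hT, ← hp, ← hq]
    ring
  rw [hsum, outerWeight, gecoGain, ← hl]
  ring

theorem gecoGain_pos {a b c Δt : ℝ} (hΔt : 0 < Δt) : 0 < gecoGain a b c Δt := by
  unfold gecoGain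
  positivity

theorem gecoKink_pos {a b c Δt : ℝ} (hΔt : 0 < Δt) (hs : 0 < a * c + b) :
    0 < gecoKink a b c Δt := by
  have := two_mul_gecoPhi_lt (mul_pos hΔt hs)
  exact mul_pos hΔt (by linarith)

/-- Trades the exponential for `φ`, which is the form in which the coefficients of `R` appear. -/
theorem gecoGain_eq (a b c Δt : ℝ) : gecoGain a b c Δt =
    Δt - 1 / 2 * gecoPhi (Δt * (a * c + b)) * Δt ^ 2 * (a * c + b) := by
  unfold gecoGain
  linear_combination (Δt / 2) * mul_gecoPhi (Δt * (a * c + b))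

theorem geco2R_eval (a b c Δt : ℝ) :
    (geco2R a b c Δt).eval (-Δt * (a * c + b)) = 1 - gecoGain a b c Δt * (a * c + b) := by
  rw [gecoGain_eq]
  simp [geco2R, testSMinus, Matrix.trace_fin_two]
  ring

/-- Cayley-Hamilton with zero determinant; it makes `R(Δt Λ)` affine in `Λ`. -/
theorem testLambda_sq (a b c : ℝ) :
    testLambda a b c ^ 2 = (-(a * c + b)) • testLambda a b c := by
  ext i j
  fin_cases i <;> fin_cases j <;>
    simp [testLambda, testSPlus, testSMinus, sq, Matrix.mul_apply, Fin.sum_univ_two] <;> ring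

theorem geco2R_aeval (a b c Δt : ℝ) :
    Polynomial.aeval (Δt • testLambda a b c) (geco2R a b c Δt) =
      1 + gecoGain a b c Δt • testLambda a b c := by
  have ht : (testSMinus a b c).trace = a * c + b := by
    simp [testSMinus, Matrix.trace_fin_two]
  rw [gecoGain_eq, geco2R, ht]
  simp only [map_add, map_mul, map_one, map_pow, Polynomial.aeval_X, Polynomial.aeval_C,
    smul_pow, testLambda_sq, Algebra.algebraMap_eq_smul_one, smul_mul_assoc, one_mul]
  module

theorem charpoly_one_add_smul_testLambda_roots (a b c k : ℝ) :
    (1 + k • testLambda a b c).charpoly.roots = {1, 1 - k * (a * c + b)} := by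
  have h : (1 + k • testLambda a b c).charpoly =
      (Polynomial.X - Polynomial.C 1) * (Polynomial.X - Polynomial.C (1 - k * (a * c + b))) := by
    have ht : (1 + k • testLambda a b c).trace = 1 + (1 - k * (a * c + b)) := by
      simp [testLambda, testSPlus, testSMinus, Matrix.trace_fin_two]
      ring
    have hd : (1 + k • testLambda a b c).det = 1 - k * (a * c + b) := by
      simp [testLambda, testSPlus, testSMinus, Matrix.det_fin_two]
      ring
    rw [Matrix.charpoly_fin_two, ht, hd]
    simp only [map_add, map_sub, map_mul, map_one]
    ring
  rw [h, Polynomial.roots_mul (mul_ne_zero (Polynomial.X_sub_C_ne_zero _)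
    (Polynomial.X_sub_C_ne_zero _)), Polynomial.roots_X_sub_C, Polynomial.roots_X_sub_C]
  rfl

/-! ### Iteration with a conserved and a scaled coordinate. -/

section Dynamics

variable {X : Type*} {g : X → X} {inv ht μ : X → ℝ} {x₀ : X} {W : Set X}

/-- If `inv` is conserved and `ht` is multiplied by factors of absolute value at most `ρ ≤ 1` near
`x₀`, where `(inv, ht)` are local coordinates, then orbits that start near `x₀` stay near it. -/
theorem exists_forall_iterate_mem [TopologicalSpace X] {ρ : ℝ}
    (hloc : ∀ V ∈ 𝓝 x₀, ∃ η > 0, ∀ x, |inv x - inv x₀| < η → |ht x| < η → x ∈ V)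
    (hW : W ∈ 𝓝 x₀) (hinv : ∀ x ∈ W, inv (g x) = inv x) (hht : ∀ x ∈ W, ht (g x) = μ x * ht x)
    (hμ : ∀ x ∈ W, |μ x| ≤ ρ) (hρ₀ : 0 ≤ ρ) (hρ : ρ ≤ 1) :
    ∃ η > 0, ∀ x, |inv x - inv x₀| < η → |ht x| < η → ∀ n : ℕ,
      g^[n] x ∈ W ∧ inv (g^[n] x) = inv x ∧ |ht (g^[n] x)| ≤ ρ ^ n * |ht x| := by
  obtain ⟨η, hη, h⟩ := hloc W hW
  refine ⟨η, hη, fun x hx₁ hx₂ n => ?_⟩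
  induction n with
  | zero => exact ⟨h x hx₁ hx₂, rfl, by simp⟩
  | succ n ih =>
    obtain ⟨hm, hi, hb⟩ := ih
    rw [Function.iterate_succ_apply']
    have hi' : inv (g (g^[n] x)) = inv x := (hinv _ hm).trans hi
    have hb' : |ht (g (g^[n] x))| ≤ ρ ^ (n + 1) * |ht x| := by
      rw [hht _ hm, abs_mul, pow_succ']
      calc |μ (g^[n] x)| * |ht (g^[n] x)| ≤ ρ * (ρ ^ n * |ht x|) := by
            gcongr
            exact hμ _ hm
        _ = ρ * ρ ^ n * |ht x| := by ring
    -- The coordinate box of size `η` is never left: `inv` is unchanged and `|ht|` does not grow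
    -- since `ρ ≤ 1`.
    refine ⟨h _ (by rwa [hi']) (hb'.trans_lt (lt_of_le_of_lt ?_ hx₂)), hi', hb'⟩
    exact mul_le_of_le_one_left (abs_nonneg _) (pow_le_one₀ hρ₀ hρ)

theorem tendsto_iterate_of_contracting_coordinate [TopologicalSpace X] {ρ : ℝ}
    (hloc : ∀ V ∈ 𝓝 x₀, ∃ η > 0, ∀ x, |inv x - inv x₀| < η → |ht x| < η → x ∈ V)
    (hρ₀ : 0 ≤ ρ) (hρ : ρ < 1) {x : X} (hx : inv x = inv x₀)
    (h : ∀ n : ℕ, inv (g^[n] x) = inv x ∧ |ht (g^[n] x)| ≤ ρ ^ n * |ht x|) :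
    Tendsto (fun n : ℕ => g^[n] x) atTop (𝓝 x₀) := by
  rw [tendsto_iff_forall_eventually_mem]
  intro V hV
  obtain ⟨η, hη, hηV⟩ := hloc V hV
  have hlim : Tendsto (fun n : ℕ => ρ ^ n * |ht x|) atTop (𝓝 0) := by
    simpa using (tendsto_pow_atTop_nhds_zero_of_lt_one hρ₀ hρ).mul_const |ht x|
  filter_upwards [hlim.eventually_lt_const hη] with n hn
  exact hηV _ (by rw [(h n).1, hx, sub_self, abs_zero]; exact hη) ((h n).2.trans_lt hn)

/-- An orbit trapped in `W` would have `|ht|` growing like `ρ ^ n` and yet bounded by `B`. -/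
theorem eq_zero_of_expanding_coordinate {ρ B : ℝ}
    (hht : ∀ x ∈ W, ht (g x) = μ x * ht x) (hμ : ∀ x ∈ W, ρ ≤ |μ x|) (hρ : 1 < ρ)
    (hB : ∀ x ∈ W, |ht x| ≤ B) {x : X} (h : ∀ n : ℕ, g^[n] x ∈ W) : ht x = 0 := by
  have hgrow : ∀ n : ℕ, ρ ^ n * |ht x| ≤ |ht (g^[n] x)| := by
    intro n
    induction n with
    | zero => simp
    | succ n ih =>
      rw [Function.iterate_succ_apply', hht _ (h n), abs_mul, pow_succ', mul_assoc]
      exact mul_le_mul (hμ _ (h n)) ih (by positivity) (abs_nonneg _)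
  by_contra hne
  have hpos : 0 < |ht x| := abs_pos.2 hne
  obtain ⟨n, hn⟩ := pow_unbounded_of_one_lt (B / |ht x|) hρ
  rw [div_lt_iff₀ hpos] at hn
  linarith [hgrow n, hB _ (h n)]

end Dynamics

/-! ### Stability and instability of the steady state. -/

theorem isOpen_posVectors (ι : Type*) [Finite ι] : IsOpen (posVectors ι) := by
  simp only [posVectors, Set.ofPred_forall]
  exact isOpen_iInter_of_finite fun i => isOpen_lt continuous_const (continuous_apply i)

theorem continuousAt_outerWeight (a b c C : ℝ) {y : Fin 2 → ℝ} (hy : y ∈ posVectors (Fin 2)) :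
    ContinuousAt (outerWeight a b c C) y := by
  have hl : ContinuousAt (fun z => steadyFunctional a b z) y :=
    (steadyFunctional a b).continuous.continuousAt
  have h0 : ContinuousAt (fun z : Fin 2 → ℝ => z 0) y := continuousAt_apply 0 y
  have h1 : ContinuousAt (fun z : Fin 2 → ℝ => z 1) y := continuousAt_apply 1 y
  refine (contDiff_gecoPhi (n := 0)).continuous.continuousAt.comp ?_
  exact continuousAt_const.mul (((continuousAt_const.max hl).div h1 (hy 1).ne').add
    ((continuousAt_const.mul (continuousAt_const.max hl.neg)).div h0 (hy 0).ne'))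

theorem outerWeight_of_steady {a b : ℝ} (c C : ℝ) {y : Fin 2 → ℝ}
    (h : steadyFunctional a b y = 0) : outerWeight a b c C y = 1 := by
  simp [outerWeight, h, gecoPhi_zero]

theorem invariant_steadyFunctional_coordinates {a b c : ℝ} (hs : 0 < a * c + b) {x₀ : Fin 2 → ℝ}
    (hx₀ : steadyFunctional a b x₀ = 0) {V : Set (Fin 2 → ℝ)} (hV : V ∈ 𝓝 x₀) :
    ∃ η > 0, ∀ x, |![1, c] ⬝ᵥ x - ![1, c] ⬝ᵥ x₀| < η → |steadyFunctional a b x| < η → x ∈ V := by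
  -- Inverse of the linear map `(inv, ℓ)`, by Cramer's rule with determinant `a c + b`.
  let Ψ : ℝ × ℝ → Fin 2 → ℝ := fun p =>
    ![(b * p.1 - c * p.2) / (a * c + b), (a * p.1 + p.2) / (a * c + b)]
  have hΨ : ∀ x, Ψ (![1, c] ⬝ᵥ x, steadyFunctional a b x) = x := by
    intro x
    ext i
    fin_cases i <;>
      simp [Ψ, steadyFunctional_apply, dotProduct, Fin.sum_univ_two, div_eq_iff hs.ne'] <;> ring
  have hc : Continuous Ψ := by
    refine continuous_pi fun i => ?_
    fin_cases i <;> simp [Ψ] <;> fun_prop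
  have hmem : Ψ ⁻¹' V ∈ 𝓝 (![1, c] ⬝ᵥ x₀, (0 : ℝ)) := by
    apply hc.continuousAt
    rwa [← hx₀, hΨ]
  obtain ⟨η, hη, hball⟩ := Metric.mem_nhds_iff.1 hmem
  refine ⟨η, hη, fun x h₁ h₂ => ?_⟩
  have : (![1, c] ⬝ᵥ x, steadyFunctional a b x) ∈ Metric.ball (![1, c] ⬝ᵥ x₀, (0 : ℝ)) η := by
    simp only [Metric.mem_ball, Prod.dist_eq, Real.dist_eq, sub_zero]
    exact max_lt h₁ h₂
  exact hΨ x ▸ hball this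

section Scheme

variable {a b c Δt : ℝ} {ystar : Fin 2 → ℝ}

theorem geco2Map_fixed (hc : 0 < c) (hΔt : 0 < Δt) (hs : 0 < a * c + b)
    (hpos : ystar ∈ posVectors (Fin 2)) (h0 : steadyFunctional a b ystar = 0) :
    geco2Map a b c Δt ystar = ystar := by
  simp [geco2Map_eq hc hΔt hs hpos, h0]

theorem invariant_geco2Map (hc : 0 < c) (hΔt : 0 < Δt) (hs : 0 < a * c + b)
    {y : Fin 2 → ℝ} (hy : y ∈ posVectors (Fin 2)) :
    ![1, c] ⬝ᵥ geco2Map a b c Δt y = ![1, c] ⬝ᵥ y := by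
  rw [geco2Map_eq hc hΔt hs hy, dotProduct_add, dotProduct_smul]
  simp [dotProduct, Fin.sum_univ_two]

theorem steadyFunctional_geco2Map (hc : 0 < c) (hΔt : 0 < Δt) (hs : 0 < a * c + b)
    {y : Fin 2 → ℝ} (hy : y ∈ posVectors (Fin 2)) :
    steadyFunctional a b (geco2Map a b c Δt y) =
      (1 - gecoGain a b c Δt * outerWeight a b c (gecoKink a b c Δt) y * (a * c + b)) *
        steadyFunctional a b y := by
  rw [geco2Map_eq hc hΔt hs hy, map_add, map_smul, steadyFunctional_dir, smul_eq_mul]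
  ring

theorem continuousAt_factor (hpos : ystar ∈ posVectors (Fin 2)) :
    ContinuousAt (fun y => |1 - gecoGain a b c Δt *
      outerWeight a b c (gecoKink a b c Δt) y * (a * c + b)|) ystar :=
  (continuousAt_const.sub ((continuousAt_const.mul
    (continuousAt_outerWeight a b c _ hpos)).mul continuousAt_const)).abs

theorem geco2Map_stable (hc : 0 < c) (hΔt : 0 < Δt) (hs : 0 < a * c + b)
    (hpos : ystar ∈ posVectors (Fin 2)) (h0 : steadyFunctional a b ystar = 0)
    (hR : |1 - gecoGain a b c Δt * (a * c + b)| < 1) :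
    IsLyapunovStable (geco2Map a b c Δt) (posVectors (Fin 2)) ystar ∧
      ∃ δ > 0, ∀ y₀ ∈ posVectors (Fin 2), ![1, c] ⬝ᵥ y₀ = ![1, c] ⬝ᵥ ystar → ‖y₀ - ystar‖ < δ →
        Tendsto (fun n : ℕ => (geco2Map a b c Δt)^[n] y₀) atTop (𝓝 ystar) := by
  -- The gap between the limiting multiplier and `ρ` absorbs the variation of the outer weight near
  -- the steady state.
  obtain ⟨ρ, hρ₁, hρ₂⟩ := exists_between hR
  have hρ₀ : 0 ≤ ρ := (abs_nonneg _).trans hρ₁.le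
  have hloc : ∀ V ∈ 𝓝 ystar, ∃ η > 0, ∀ x, |![1, c] ⬝ᵥ x - ![1, c] ⬝ᵥ ystar| < η →
      |steadyFunctional a b x| < η → x ∈ V := fun V hV =>
    invariant_steadyFunctional_coordinates hs h0 hV
  have hev : ∀ᶠ y in 𝓝 ystar, y ∈ posVectors (Fin 2) ∧ |1 - gecoGain a b c Δt *
      outerWeight a b c (gecoKink a b c Δt) y * (a * c + b)| < ρ := by
    refine ((isOpen_posVectors (Fin 2)).eventually_mem hpos).and
      ((continuousAt_factor hpos).eventually_lt_const ?_)
    simpa only [outerWeight_of_steady _ _ h0, mul_one] using hρ₁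
  -- Taking `U` to be a ball yields stability; `U = univ` suffices for convergence.
  have horbit : ∀ U ∈ 𝓝 ystar, ∃ δ > 0, ∀ y₀, ‖y₀ - ystar‖ < δ → ∀ n : ℕ,
      (geco2Map a b c Δt)^[n] y₀ ∈ U ∧
      ![1, c] ⬝ᵥ (geco2Map a b c Δt)^[n] y₀ = ![1, c] ⬝ᵥ y₀ ∧
      |steadyFunctional a b ((geco2Map a b c Δt)^[n] y₀)| ≤
        ρ ^ n * |steadyFunctional a b y₀| := by
    intro U hU
    obtain ⟨η, hη, h⟩ := exists_forall_iterate_mem (inv := fun y => ![1, c] ⬝ᵥ y)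
      (ht := fun y => steadyFunctional a b y) hloc (Filter.inter_mem hU hev)
      (fun x hx => invariant_geco2Map hc hΔt hs hx.2.1)
      (fun x hx => steadyFunctional_geco2Map hc hΔt hs hx.2.1)
      (fun x hx => hx.2.2.le) hρ₀ hρ₂.le
    have hnear : ∀ᶠ y in 𝓝 ystar, |![1, c] ⬝ᵥ y - ![1, c] ⬝ᵥ ystar| < η ∧
        |steadyFunctional a b y| < η := by
      have c₁ : Continuous fun y : Fin 2 → ℝ => |![1, c] ⬝ᵥ y - ![1, c] ⬝ᵥ ystar| := by
        simp only [dotProduct]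
        fun_prop
      have c₂ : Continuous fun y : Fin 2 → ℝ => |steadyFunctional a b y| := by fun_prop
      exact ((c₁.tendsto ystar).eventually_lt_const (by simpa using hη)).and
        ((c₂.tendsto ystar).eventually_lt_const (by simpa [h0] using hη))
    obtain ⟨δ, hδ, hδ'⟩ := Metric.eventually_nhds_iff.1 hnear
    refine ⟨δ, hδ, fun y₀ hy₀ n => ?_⟩
    rw [← dist_eq_norm] at hy₀
    obtain ⟨h₁, h₂⟩ := hδ' hy₀
    exact ⟨(h y₀ h₁ h₂ n).1.1, (h y₀ h₁ h₂ n).2⟩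
  refine ⟨⟨geco2Map_fixed hc hΔt hs hpos h0, fun ε hε => ?_⟩, ?_⟩
  · obtain ⟨δ, hδ, h⟩ := horbit _ (Metric.ball_mem_nhds ystar hε)
    exact ⟨δ, hδ, fun y₀ _ hy₀ n => mem_ball_iff_norm.1 (h y₀ hy₀ n).1⟩
  · obtain ⟨δ, hδ, h⟩ := horbit _ univ_mem
    exact ⟨δ, hδ, fun y₀ _ hinv hy₀ => tendsto_iterate_of_contracting_coordinate hloc hρ₀ hρ₂ hinv
      fun n => (h y₀ hy₀ n).2⟩

theorem geco2Map_unstable (hc : 0 < c) (hΔt : 0 < Δt) (hs : 0 < a * c + b)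
    (hpos : ystar ∈ posVectors (Fin 2)) (h0 : steadyFunctional a b ystar = 0)
    (hR : 1 < |1 - gecoGain a b c Δt * (a * c + b)|) :
    IsUnstable (geco2Map a b c Δt) (posVectors (Fin 2)) ystar := by
  refine ⟨geco2Map_fixed hc hΔt hs hpos h0, fun hst => ?_⟩
  obtain ⟨ρ, hρ₁, hρ₂⟩ := exists_between hR
  have hc₁ : Continuous fun y : Fin 2 → ℝ => |steadyFunctional a b y| := by fun_prop
  have hev : ∀ᶠ y in 𝓝 ystar, (y ∈ posVectors (Fin 2) ∧ ρ < |1 - gecoGain a b c Δt *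
      outerWeight a b c (gecoKink a b c Δt) y * (a * c + b)|) ∧
      |steadyFunctional a b y| < 1 := by
    refine (((isOpen_posVectors (Fin 2)).eventually_mem hpos).and
      ((continuousAt_factor hpos).eventually_const_lt ?_)).and
      ((hc₁.tendsto ystar).eventually_lt_const ?_)
    · simpa only [outerWeight_of_steady _ _ h0, mul_one] using hρ₂
    · simp [h0]
  obtain ⟨ε, hε, hball⟩ := Metric.eventually_nhds_iff_ball.1 hev
  obtain ⟨δ, hδ, h⟩ := hst.2 ε hε
  -- Starting points are displaced along `v`, where `ℓ = -t s` is nonzero for `t ≠ 0`.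
  have hline : Tendsto (fun t : ℝ => ystar + t • ![c, -1]) (𝓝[≠] 0) (𝓝 ystar) := by
    have : Continuous fun t : ℝ => ystar + t • ![c, -1] := by fun_prop
    simpa using (this.tendsto 0).mono_left nhdsWithin_le_nhds
  obtain ⟨t, ⟨ht₁, ht₂⟩, ht₀⟩ := ((hline.eventually
    ((Metric.isOpen_ball.eventually_mem (Metric.mem_ball_self hδ)).and
      ((isOpen_posVectors (Fin 2)).eventually_mem hpos))).and self_mem_nhdsWithin).exists
  have hzero : steadyFunctional a b (ystar + t • ![c, -1]) = 0 :=
    eq_zero_of_expanding_coordinate (W := Metric.ball ystar ε)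
      (ht := fun y => steadyFunctional a b y)
      (fun x hx => steadyFunctional_geco2Map hc hΔt hs (hball x hx).1.1)
      (fun x hx => (hball x hx).1.2.le) hρ₁ (fun x hx => (hball x hx).2.le)
      (fun n => mem_ball_iff_norm.2 (h _ ht₂ (mem_ball_iff_norm.1 ht₁) n))
  rw [map_add, map_smul, h0, steadyFunctional_dir, smul_eq_mul, zero_add] at hzero
  exact (mul_ne_zero ht₀ (neg_ne_zero.2 hs.ne')) hzero

end Scheme

/-! ### Smoothness of the scheme, and its failure at second order. -/

section Smoothness

variable {a b c k : ℝ} {θ : (Fin 2 → ℝ) → ℝ} {y : Fin 2 → ℝ}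

theorem contDiffAt_weightedStep (a b c k : ℝ) (hθ : ContDiffAt ℝ 2 θ y) :
    ContDiffAt ℝ 2 (fun y => y + (k * gecoPhi (θ y) * steadyFunctional a b y) • ![c, -1]) y :=
  contDiffAt_fun_id.add (((contDiffAt_const.mul (contDiff_gecoPhi.contDiffAt.comp y hθ)).mul
    (steadyFunctional a b).contDiff.contDiffAt).smul contDiffAt_const)

/-- The derivative of `θ` drops out because it is multiplied by `ℓ(y) = 0`. The result is
independent of `θ`, so the two branches agree to first order. -/
theorem hasFDerivAt_weightedStep (c k : ℝ) (hθ : ContDiffAt ℝ 2 θ y) (hθy : θ y = 0)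
    (hy : steadyFunctional a b y = 0) :
    HasFDerivAt (fun y => y + (k * gecoPhi (θ y) * steadyFunctional a b y) • ![c, -1])
      (ContinuousLinearMap.id ℝ (Fin 2 → ℝ) +
        (k • steadyFunctional a b).smulRight ![c, -1]) y := by
  have h : DifferentiableAt ℝ (fun y => k * gecoPhi (θ y)) y :=
    (contDiffAt_const.mul (contDiff_gecoPhi.contDiffAt.comp y hθ)).differentiableAt
      (two_ne_zero)
  have h' := hasFDerivAt_mul_of_apply_eq_zero h hy
  rw [hθy, gecoPhi_zero, mul_one] at h'
  exact (hasFDerivAt_id y).add (h'.smul_const ![c, -1])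

theorem contDiffAt_rightKink (a b C : ℝ) (hy : y ∈ posVectors (Fin 2)) :
    ContDiffAt ℝ 2 (fun y => C * (steadyFunctional a b y / y 1)) y :=
  contDiffAt_const.mul ((steadyFunctional a b).contDiff.contDiffAt.div
    (contDiff_apply ℝ ℝ 1).contDiffAt (hy 1).ne')

theorem contDiffAt_leftKink (a b c C : ℝ) (hy : y ∈ posVectors (Fin 2)) :
    ContDiffAt ℝ 2 (fun y => C * (c * -steadyFunctional a b y / y 0)) y :=
  contDiffAt_const.mul ((contDiffAt_const.mul (steadyFunctional a b).contDiff.contDiffAt.neg).div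
    (contDiff_apply ℝ ℝ 0).contDiffAt (hy 0).ne')

theorem outerWeight_of_nonneg (c C : ℝ) (h : 0 ≤ steadyFunctional a b y) :
    outerWeight a b c C y = gecoPhi (C * (steadyFunctional a b y / y 1)) := by
  simp [outerWeight, max_eq_right h, max_eq_left (neg_nonpos.2 h)]

theorem outerWeight_of_nonpos (c C : ℝ) (h : steadyFunctional a b y ≤ 0) :
    outerWeight a b c C y = gecoPhi (C * (c * -steadyFunctional a b y / y 0)) := by
  simp [outerWeight, max_eq_left h, max_eq_right (neg_nonneg.2 h)]

variable {Δt : ℝ} {ystar : Fin 2 → ℝ}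

theorem geco2Map_exists_contDiffOn_one (hc : 0 < c) (hΔt : 0 < Δt) (hs : 0 < a * c + b)
    (hpos : ystar ∈ posVectors (Fin 2)) :
    ∃ D : Set (Fin 2 → ℝ), IsOpen D ∧ ystar ∈ D ∧ D ⊆ posVectors (Fin 2) ∧
      ContDiffOn ℝ 1 (geco2Map a b c Δt) D ∧
      ∃ K : ℝ≥0, LipschitzOnWith K (fderiv ℝ (geco2Map a b c Δt)) D := by
  obtain ⟨D, hDs, hDo, hyD, hD, hK⟩ := exists_contDiffOn_one_lipschitzOnWith_fderiv
    (L := steadyFunctional a b) (isOpen_posVectors (Fin 2)) hpos (f := geco2Map a b c Δt)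
    (fun x hx hl => by rw [geco2Map_eq hc hΔt hs hx, outerWeight_of_nonneg _ _ hl])
    (fun x hx hl => by rw [geco2Map_eq hc hΔt hs hx, outerWeight_of_nonpos _ _ hl])
    (fun x hx => contDiffAt_weightedStep a b c _ (contDiffAt_rightKink a b _ hx))
    (fun x hx => contDiffAt_weightedStep a b c _ (contDiffAt_leftKink a b c _ hx))
    (fun x hx hl => by
      rw [(hasFDerivAt_weightedStep c _ (contDiffAt_rightKink a b _ hx) (by simp [hl]) hl).fderiv,
        (hasFDerivAt_weightedStep c _ (contDiffAt_leftKink a b c _ hx) (by simp [hl]) hl).fderiv])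
  exact ⟨D, hDo, hyD, hDs, hD, hK⟩

theorem hasFDerivAt_geco2Map (hc : 0 < c) (hΔt : 0 < Δt) (hs : 0 < a * c + b)
    (hpos : ystar ∈ posVectors (Fin 2)) (h0 : steadyFunctional a b ystar = 0) :
    HasFDerivAt (geco2Map a b c Δt) (Matrix.toLin'
      (1 + gecoGain a b c Δt • testLambda a b c)).toContinuousLinearMap ystar := by
  have h : ContinuousLinearMap.id ℝ (Fin 2 → ℝ) +
      (gecoGain a b c Δt • steadyFunctional a b).smulRight ![c, -1] = (Matrix.toLin'
      (1 + gecoGain a b c Δt • testLambda a b c)).toContinuousLinearMap := by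
    refine ContinuousLinearMap.ext fun y => ?_
    rw [LinearMap.coe_toContinuousLinearMap', Matrix.toLin'_apply, Matrix.add_mulVec,
      Matrix.one_mulVec, Matrix.smul_mulVec, testLambda_mulVec, smul_smul]
    rfl
  rw [← h]
  have h' := hasFDerivAt_of_eq_on_halfspaces (L := steadyFunctional a b)
    (isOpen_posVectors (Fin 2)) (f := geco2Map a b c Δt)
    (fun x hx hl => by rw [geco2Map_eq hc hΔt hs hx, outerWeight_of_nonneg _ _ hl])
    (fun x hx hl => by rw [geco2Map_eq hc hΔt hs hx, outerWeight_of_nonpos _ _ hl])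
    (fun x hx => ((contDiffAt_weightedStep a b c _
      (contDiffAt_rightKink a b _ hx)).differentiableAt two_ne_zero).hasFDerivAt)
    (fun x hx => ((contDiffAt_weightedStep a b c _
      (contDiffAt_leftKink a b c _ hx)).differentiableAt two_ne_zero).hasFDerivAt)
    (fun x hx hl => by
      rw [(hasFDerivAt_weightedStep c _ (contDiffAt_rightKink a b _ hx) (by simp [hl]) hl).fderiv,
        (hasFDerivAt_weightedStep c _ (contDiffAt_leftKink a b c _ hx) (by simp [hl]) hl).fderiv])
    hpos
  rwa [if_pos h0.ge, (hasFDerivAt_weightedStep c _ (contDiffAt_rightKink a b _ hpos)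
    (by simp [h0]) h0).fderiv] at h'

theorem geco2Map_not_contDiffAt_two (hc : 0 < c) (hΔt : 0 < Δt) (hs : 0 < a * c + b)
    (hpos : ystar ∈ posVectors (Fin 2)) (h0 : steadyFunctional a b ystar = 0) :
    ¬ ContDiffAt ℝ 2 (geco2Map a b c Δt) ystar := by
  intro hg
  set s := a * c + b with hs_def
  set C := gecoKink a b c Δt with hC_def
  have hC : 0 < C := gecoKink_pos hΔt hs
  have hk : 0 < gecoGain a b c Δt := gecoGain_pos hΔt
  have hy0 := hpos 0
  have hy1 := hpos 1
  let γ : ℝ → Fin 2 → ℝ := fun t => ystar + t • ![c, -1]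
  have hγ : ContDiff ℝ 2 γ := contDiff_const.add (contDiff_id.smul contDiff_const)
  have hγ0 : γ 0 = ystar := by simp only [γ, zero_smul, add_zero]
  have hγ_pos : ∀ᶠ t in 𝓝 (0 : ℝ), γ t ∈ posVectors (Fin 2) :=
    hγ.continuous.continuousAt.eventually_mem
      ((isOpen_posVectors (Fin 2)).mem_nhds (hγ0 ▸ hpos))
  have hlγ : ∀ t, steadyFunctional a b (γ t) = -(s * t) := fun t => by
    simp only [γ, map_add, map_smul, h0, steadyFunctional_dir, smul_eq_mul]
    ring
  have hγ1 : ∀ t, γ t 1 = ystar 1 - t := fun t => by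
    simp only [γ, Pi.add_apply, Pi.smul_apply, Matrix.cons_val_one, Matrix.cons_val_fin_one,
      smul_eq_mul]
    ring
  have hγ2 : ∀ t, γ t 0 = ystar 0 + c * t := fun t => by
    simp only [γ, Pi.add_apply, Pi.smul_apply, Matrix.cons_val_zero, smul_eq_mul]
    ring
  -- Normalized so that along `γ` this quotient is exactly `t` times the outer weight.
  have hf : ContDiffAt ℝ 2 (fun t => (geco2Map a b c Δt (γ t) 1 - ystar 1 + t) /
      (gecoGain a b c Δt * s)) 0 := by
    have h1 : ContDiffAt ℝ 2 (fun t => geco2Map a b c Δt (γ t)) 0 :=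
      ContDiffAt.comp (0 : ℝ) (hγ0.symm ▸ hg) hγ.contDiffAt
    exact (((contDiffAt_pi.1 h1 1).sub contDiffAt_const).add contDiffAt_fun_id).div_const _
  have hval : ∀ᶠ t in 𝓝 (0 : ℝ), (geco2Map a b c Δt (γ t) 1 - ystar 1 + t) /
      (gecoGain a b c Δt * s) = t * outerWeight a b c C (γ t) := by
    filter_upwards [hγ_pos] with t ht
    rw [geco2Map_eq hc hΔt hs ht, hlγ]
    simp only [Pi.add_apply, hγ1, Pi.smul_apply, Matrix.cons_val_one, smul_eq_mul, ← hC_def,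
      Matrix.cons_val_fin_one]
    field_simp
    ring
  -- On each side the argument of `φ` is a quotient `n / d` with `n 0 = 0`, whose slope at `0` is
  -- `n' / d 0`.
  have hθ : ∀ {n d : ℝ → ℝ} {n' d' : ℝ}, ContDiff ℝ 2 n → ContDiff ℝ 2 d → HasDerivAt n n' 0 →
      HasDerivAt d d' 0 → n 0 = 0 → d 0 ≠ 0 →
      ContDiffAt ℝ 2 (fun t => gecoPhi (n t / d t)) 0 ∧
        deriv (fun t => gecoPhi (n t / d t)) 0 = -1 / 2 * (n' / d 0) := by
    intro n d n' d' hn hd hn' hd' hn0 hd0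
    refine ⟨contDiff_gecoPhi.contDiffAt.comp (0 : ℝ) (hn.contDiffAt.div hd.contDiffAt hd0), ?_⟩
    have hq : HasDerivAt (fun t => n t / d t) (n' / d 0) 0 := by
      refine (hn'.fun_div hd' hd0).congr_deriv ?_
      rw [hn0]
      field_simp
      ring
    have hq0 : n 0 / d 0 = 0 := by rw [hn0, zero_div]
    have hphi : HasDerivAt gecoPhi (-1 / 2) (n 0 / d 0) := hq0.symm ▸ hasDerivAt_gecoPhi_zero
    exact (hphi.comp (0 : ℝ) hq).deriv
  have hlin : ∀ m : ℝ, HasDerivAt (fun t : ℝ => m * t) m 0 := fun m => by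
    simpa using (hasDerivAt_id' (0 : ℝ)).const_mul m
  obtain ⟨c₁, d₁⟩ := hθ (n := fun t => C * c * s * t) (d := fun t => ystar 0 + c * t)
    (by fun_prop) (by fun_prop) (hlin _) ((hlin c).const_add _) (by simp) (by simpa using hy0.ne')
  obtain ⟨c₂, d₂⟩ := hθ (n := fun t => -(C * s) * t) (d := fun t => ystar 1 + (-1) * t)
    (by fun_prop) (by fun_prop) (hlin _) ((hlin (-1)).const_add _) (by simp)
    (by simpa using hy1.ne')
  have heq := deriv_eq_of_contDiffAt_two hf c₁ c₂
    (by
      filter_upwards [hval] with t ht ht0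
      have hl : steadyFunctional a b (γ t) ≤ 0 := by
        rw [hlγ]
        exact neg_nonpos.2 (mul_nonneg hs.le ht0)
      rw [ht, outerWeight_of_nonpos _ _ hl, hlγ, hγ2]
      congr 2
      ring)
    (by
      filter_upwards [hval] with t ht ht0
      have hl : 0 ≤ steadyFunctional a b (γ t) := by
        rw [hlγ]
        exact neg_nonneg.2 (mul_nonpos_of_nonneg_of_nonpos hs.le ht0)
      rw [ht, outerWeight_of_nonneg _ _ hl, hlγ, hγ1]
      congr 2
      ring)
  -- The two derivatives are `-C c s / (2 y₀*)` and `C s / (2 y₁*)`, of opposite strict signs.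
  rw [d₁, d₂] at heq
  simp only [mul_zero, add_zero, neg_div, mul_neg] at heq
  have p₁ : 0 < C * c * s / ystar 0 := by positivity
  have p₂ : 0 < C * s / ystar 1 := by positivity
  linarith

end Smoothness

theorem mainTheorem11 (a b c Δt : ℝ) (ha : 0 ≤ a) (hb : 0 ≤ b) (hab : 0 < a + b) (hc : 0 < c)
    (hΔt : 0 < Δt) (ystar : Fin 2 → ℝ) (hpos : ystar ∈ posVectors (Fin 2))
    (hsteady : testLambda a b c *ᵥ ystar = 0) :
    -- `g` is `C¹` with Lipschitz continuous derivative on a neighborhood of the steady state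
    (∃ D : Set (Fin 2 → ℝ), IsOpen D ∧ ystar ∈ D ∧ D ⊆ posVectors (Fin 2) ∧
      ContDiffOn ℝ 1 (geco2Map a b c Δt) D ∧
      ∃ K : ℝ≥0, LipschitzOnWith K (fderiv ℝ (geco2Map a b c Δt)) D) ∧
    -- the stability function, and the eigenvalues of the Jacobian with multiplicities
    IsStabilityFunctionAt (geco2R a b c Δt) (geco2Map a b c Δt) (testLambda a b c) Δt ystar ∧
    (LinearMap.toMatrix' (fderiv ℝ (geco2Map a b c Δt) ystar : (Fin 2 → ℝ) →ₗ[ℝ] Fin 2 → ℝ)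
      ).charpoly.roots = {1, (geco2R a b c Δt).eval (-Δt * (a * c + b))} ∧
    -- stability, and local convergence on the invariant line
    (|(geco2R a b c Δt).eval (-Δt * (a * c + b))| < 1 →
      IsLyapunovStable (geco2Map a b c Δt) (posVectors (Fin 2)) ystar ∧
      ∃ δ > 0, ∀ y₀ ∈ posVectors (Fin 2), ![1, c] ⬝ᵥ y₀ = ![1, c] ⬝ᵥ ystar → ‖y₀ - ystar‖ < δ →
        Tendsto (fun n : ℕ => (geco2Map a b c Δt)^[n] y₀) atTop (𝓝 ystar)) ∧
    -- instability
    (1 < |(geco2R a b c Δt).eval (-Δt * (a * c + b))| →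
      IsUnstable (geco2Map a b c Δt) (posVectors (Fin 2)) ystar) ∧
    -- `g` is not `C²` on any neighborhood of the steady state
    (∀ U ∈ 𝓝 ystar, ¬ ContDiffOn ℝ 2 (geco2Map a b c Δt) U) := by
  have hs : 0 < a * c + b := by
    rcases ha.eq_or_lt with rfl | ha
    · simpa using hab
    · positivity
  have h0 := steadyFunctional_eq_zero hsteady
  have hJ := hasFDerivAt_geco2Map hc hΔt hs hpos h0
  rw [geco2R_eval]
  refine ⟨geco2Map_exists_contDiffOn_one hc hΔt hs hpos, ?_, ?_,
    geco2Map_stable hc hΔt hs hpos h0, geco2Map_unstable hc hΔt hs hpos h0, fun U hU hC => ?_⟩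
  · rwa [IsStabilityFunctionAt, geco2R_aeval]
  · rw [hJ.fderiv, LinearMap.coe_toContinuousLinearMap, LinearMap.toMatrix'_toLin']
    exact charpoly_one_add_smul_testLambda_roots _ _ _ _
  · exact geco2Map_not_contDiffAt_two hc hΔt hs hpos h0 (hC.contDiffAt hU)
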